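/- Let $R$ be a left and right Noetherian ring (associative with identity) and let $A$ be a finitely generated left $R$-module. Write $(-)^*=\operatorname{Hom}(-,R)$. A left module $G$ over a ring $S$ is Gorenstein projective if there is an exact sequence of projective $S$-modules $\cdots\to P_1\to P_0\to P^0\to P^1\to\cdots$ that remains exact under $\operatorname{Hom}_S(-,P)$ for every projective $S$-module $P$, and $G\cong\operatorname{Im}(P_0\to P^0)$. The Gorenstein projective dimension $\operatorname{Gpd}_S(M)\in\mathbb N\cup\{\infty\}$ is the infimum of all $n\ge 0$ for which there exists an exact sequence $0\to G_n\to\cdots\to G_0\to M\to 0$ with all $G_i$ Gorenstein projective. A Gorenstein transpose of a finitely generated (left or right) $R$-module $B$ is a module isomorphic to $\operatorname{Coker}(g^*: X_0^*\to X_1^*)$ for some exact sequence $X_1\xrightarrow{g}X_0\to B\to 0$ with $X_0,X_1$ finitely generated Gorenstein projective; it is a module on the opposite side. If $X_0,X_1$ are projective, it is called a transpose of $B$, denoted $\operatorname{Tr}B$ (unique up to projective equivalence). For $n\ge1$, a finitely generated left $R$-module $B$ is $n$-torsionfree if $\operatorname{Ext}^i_{R^{op}}(\operatorname{Tr}B,R)=0$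 for all $1\le i\le n$. Let the right $R$-module $M$ be any Gorenstein transpose of $A$, and let the left $R$-module $N$ be any Gorenstein transpose of $M$. Then: 1. $\operatorname{Ext}^i_R(N,R)\cong\operatorname{Ext}^i_R(A,R)$ as right $R$-modules for every $i\ge 1$. 2. For every $n\ge 1$, $N$ is $n$-torsionfree if and only if $A$ is $n$-torsionfree. 3. $\operatorname{Gpd}_R(N)=\operatorname{Gpd}_R(A)$. -/

import Mathlib

open CategoryTheory

universe u

namespace GorensteinTranspose

/-! ## Gorenstein projective modules and Gorenstein projective dimension -/

section Gorenstein

variable (S : Type u) [Ring S]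

/-- A module `G` is Gorenstein projective if there is an exact sequence
`⋯ → P 2 → P 1 → P 0 → P (-1) → ⋯` of projective modules (indexed by all integers) which
stays exact after applying `Hom(-, Q)` for every projective module `Q`, and such that `G` is
isomorphic to the image of `P 1 → P 0`. No finiteness is imposed on the `P i` and `Q`. -/
def IsGorensteinProjective (G : Type u) [AddCommGroup G] [Module S G] : Prop :=
  ∃ (P : ℤ → ModuleCat.{u} S) (d : ∀ i : ℤ, P (i + 1) →ₗ[S] P i),
    (∀ i, Module.Projective S (P i)) ∧
    (∀ i, Function.Exact (d (i + 1)) (d i)) ∧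
    (∀ Q : ModuleCat.{u} S, Module.Projective S Q → ∀ i : ℤ,
      Function.Exact (fun h : P i →ₗ[S] Q => h ∘ₗ d i)
        (fun h : P (i + 1) →ₗ[S] Q => h ∘ₗ d (i + 1))) ∧
    Nonempty (G ≃ₗ[S] LinearMap.range (d 0))

/-- There is an exact sequence `0 → G n → ⋯ → G 1 → G 0 → M → 0` with all `G i` Gorenstein
projective. The sequence is indexed by all natural numbers, with `G i = 0` for `i > n`. -/
def HasGorensteinResolution (n : ℕ) (M : Type u) [AddCommGroup M] [Module S M] : Prop :=
  ∃ (G : ℕ → ModuleCat.{u} S) (d : ∀ i : ℕ, G (i + 1) →ₗ[S] G i) (ε : G 0 →ₗ[S] M),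
    (∀ i ≤ n, IsGorensteinProjective S (G i)) ∧
    (∀ i > n, Subsingleton (G i)) ∧
    (∀ i, Function.Exact (d (i + 1)) (d i)) ∧
    Function.Exact (d 0) ε ∧
    Function.Surjective ε

/-- The Gorenstein projective dimension: the infimum of the lengths `n` of the resolutions of
`M` by Gorenstein projective modules, and `⊤` if there is no finite one. -/
noncomputable def Gpd (M : Type u) [AddCommGroup M] [Module S M] : ℕ∞ :=
  ⨅ (n : ℕ) (_ : HasGorensteinResolution S n M), (n : ℕ∞)

end Gorenstein

/-! ## Duals, Ext and transposes

Everything is written for two rings `S`, `T` and an abelian group `D` with commuting actions of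
`S` and `T`, so that left and right modules over a ring `R` are treated at once: left modules are
the case `S = R`, `T = Rᵐᵒᵖ`, `D = R`, and right modules are the case `S = Rᵐᵒᵖ`, `T = R`, `D = R`. -/

section Bimodule

variable (S T D : Type u) [Ring S] [Ring T] [AddCommGroup D] [Module S D] [Module T D]
  [SMulCommClass S T D]

/-- The `T`-linear map `g^* : Hom_S(Y, D) → Hom_S(X, D)`, `h ↦ h ∘ g`. -/
def dualMap {X Y : Type u} [AddCommGroup X] [Module S X] [AddCommGroup Y] [Module S Y]
    (g : X →ₗ[S] Y) : (Y →ₗ[S] D) →ₗ[T] (X →ₗ[S] D) where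
  toFun h := h ∘ₗ g
  map_add' _ _ := rfl
  map_smul' _ _ := rfl

/-- `Ext_S^i(X, D)`. -/
def ExtD (X : Type u) [AddCommGroup X] [Module S X] (i : ℕ) : Type u :=
  Abelian.Ext.{u} (ModuleCat.of S X) (ModuleCat.of S D) i

noncomputable instance (X : Type u) [AddCommGroup X] [Module S X] (i : ℕ) :
    AddCommGroup (ExtD S D X i) :=
  inferInstanceAs (AddCommGroup (Abelian.Ext.{u} (ModuleCat.of S X) (ModuleCat.of S D) i))

/-- Multiplication by `t : T` on `D`, as a morphism of `S`-modules. -/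
def mulHom (t : T) : ModuleCat.of S D ⟶ ModuleCat.of S D :=
  ModuleCat.ofHom
    { toFun := fun x => t • x
      map_add' := fun x y => smul_add t x y
      map_smul' := fun s x => (smul_comm s t x).symm }

/-- The `T`-module structure of `Ext_S^i(X, D)`, induced by functoriality in `D`: the element `t`
acts by composition with multiplication by `t` on `D`. -/
@[reducible]
noncomputable def extModule (X : ModuleCat.{u} S) (i : ℕ) :
    Module T (Abelian.Ext.{u} X (ModuleCat.of S D) i) where
  smul t x := x.comp (Abelian.Ext.mk₀ (mulHom S T D t)) (add_zero i)
  one_smul x := by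
    have h : mulHom S T D 1 = 𝟙 _ := by ext x; exact one_smul T (x : D)
    change x.comp (Abelian.Ext.mk₀ (mulHom S T D 1)) (add_zero i) = x
    rw [h, Abelian.Ext.comp_mk₀_id]
  mul_smul s t x := by
    have h : mulHom S T D (s * t) = mulHom S T D t ≫ mulHom S T D s := by
      ext x; exact mul_smul s t (x : D)
    change x.comp (Abelian.Ext.mk₀ (mulHom S T D (s * t))) (add_zero i) =
      (x.comp (Abelian.Ext.mk₀ (mulHom S T D t)) (add_zero i)).comp
        (Abelian.Ext.mk₀ (mulHom S T D s)) (add_zero i)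
    rw [h, ← Abelian.Ext.mk₀_comp_mk₀, Abelian.Ext.comp_assoc_of_third_deg_zero]
  smul_zero t := by
    change (0 : Abelian.Ext.{u} X (ModuleCat.of S D) i).comp
      (Abelian.Ext.mk₀ (mulHom S T D t)) (add_zero i) = 0
    rw [Abelian.Ext.zero_comp]
  smul_add t x y := Abelian.Ext.add_comp _ _ _ _
  add_smul s t x := by
    have h : mulHom S T D (s + t) = mulHom S T D s + mulHom S T D t := by
      ext x; exact add_smul s t (x : D)
    change x.comp (Abelian.Ext.mk₀ (mulHom S T D (s + t))) (add_zero i) =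
      x.comp (Abelian.Ext.mk₀ (mulHom S T D s)) (add_zero i) +
      x.comp (Abelian.Ext.mk₀ (mulHom S T D t)) (add_zero i)
    rw [h, Abelian.Ext.mk₀_add, Abelian.Ext.comp_add]
  zero_smul x := by
    have h : mulHom S T D 0 = 0 := by ext x; exact zero_smul T (x : D)
    change x.comp (Abelian.Ext.mk₀ (mulHom S T D 0)) (add_zero i) = 0
    rw [h, Abelian.Ext.mk₀_zero, Abelian.Ext.comp_zero]

noncomputable instance (X : Type u) [AddCommGroup X] [Module S X] (i : ℕ) :
    Module T (ExtD S D X i) :=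
  extModule S T D (ModuleCat.of S X) i

/-- The `T`-module `M` is (isomorphic to) a transpose of the `S`-module `A`, that is, the cokernel
of `f^*` for a presentation `P₁ --f--> P₀ → A → 0` by finitely generated projective modules. -/
def IsTranspose (A : Type u) [AddCommGroup A] [Module S A]
    (M : Type u) [AddCommGroup M] [Module T M] : Prop :=
  ∃ (P₁ P₀ : ModuleCat.{u} S) (f : P₁ →ₗ[S] P₀) (p : P₀ →ₗ[S] A),
    Module.Finite S P₁ ∧ Module.Finite S P₀ ∧
    Module.Projective S P₁ ∧ Module.Projective S P₀ ∧
    Function.Exact f p ∧ Function.Surjective p ∧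
    Nonempty (M ≃ₗ[T] ((P₁ →ₗ[S] D) ⧸ LinearMap.range (dualMap S T D f)))

/-- The `T`-module `M` is (isomorphic to) a Gorenstein transpose of the `S`-module `A`, that is,
the cokernel of `g^*` for a presentation `X₁ --g--> X₀ → A → 0` by finitely generated Gorenstein
projective modules. -/
def IsGorensteinTranspose (A : Type u) [AddCommGroup A] [Module S A]
    (M : Type u) [AddCommGroup M] [Module T M] : Prop :=
  ∃ (X₁ X₀ : ModuleCat.{u} S) (g : X₁ →ₗ[S] X₀) (p : X₀ →ₗ[S] A),
    Module.Finite S X₁ ∧ Module.Finite S X₀ ∧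
    IsGorensteinProjective S X₁ ∧ IsGorensteinProjective S X₀ ∧
    Function.Exact g p ∧ Function.Surjective p ∧
    Nonempty (M ≃ₗ[T] ((X₁ →ₗ[S] D) ⧸ LinearMap.range (dualMap S T D g)))

/-- `A` is `n`-torsionfree if `Ext_T^i(Tr A, D) = 0` for `1 ≤ i ≤ n`. Since `Tr A` is unique up
to projective summands, it does not matter which transpose of `A` is taken. -/
def IsTorsionfree (n : ℕ) (A : Type u) [AddCommGroup A] [Module S A] : Prop :=
  ∃ M : ModuleCat.{u} T, IsTranspose S T D A M ∧
    ∀ i : ℕ, 1 ≤ i → i ≤ n → Subsingleton (ExtD T D M i)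

end Bimodule

end GorensteinTranspose

namespace GorensteinTranspose

/-!
Finitely generated Gorenstein projective modules are reflexive, and over a left coherent ring their
duals are Gorenstein projective. Dualising the presentation that defines a Gorenstein transpose
therefore shows that the relation is symmetric, so that `A` and `N` are both Gorenstein transposes
of `M`. Any two Gorenstein transposes of one module embed into a common module with
Gorenstein projective cokernels: pull both presentations back to a common free cover, then cover
the two pulled back syzygies by one free module. Since Gorenstein projective modules are left
orthogonal to projective ones, such embeddings change neither `Ext^i(-, D)` for `i ≥ 1` nor the
Gorenstein projective dimension; and they show that the Ext groups defining torsionfreeness may be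
computed on any Gorenstein transpose.
-/

section ShortExact

variable {S : Type*} [Ring S] {N E H K P L Q : Type*} [AddCommGroup N] [Module S N]
  [AddCommGroup E] [Module S E] [AddCommGroup H] [Module S H] [AddCommGroup K] [Module S K]
  [AddCommGroup P] [Module S P] [AddCommGroup L] [Module S L] [AddCommGroup Q] [Module S Q]

/-- Short exact sequences `0 → N → E → H → 0` of modules, with the three modules in arbitrary
universes, so that sequences of duals need no bundling. -/
structure IsShortExact (f : N →ₗ[S] E) (g : E →ₗ[S] H) : Prop where
  injective : Function.Injective f
  exact : Function.Exact f g
  surjective : Function.Surjective g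

lemma IsShortExact.ker_subtype {g : E →ₗ[S] H} (hg : Function.Surjective g) :
    IsShortExact (LinearMap.ker g).subtype g :=
  ⟨Subtype.val_injective, LinearMap.exact_subtype_ker_map g, hg⟩

lemma IsShortExact.range_mkQ {f : N →ₗ[S] E} (hf : Function.Injective f) :
    IsShortExact f (LinearMap.range f).mkQ :=
  ⟨hf, LinearMap.exact_map_mkQ_range f, Submodule.mkQ_surjective _⟩

lemma IsShortExact.range_subtype_rangeRestrict {f : N →ₗ[S] E} {g : E →ₗ[S] H}
    (h : Function.Exact f g) :
    IsShortExact (LinearMap.range f).subtype g.rangeRestrict :=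
  ⟨Subtype.val_injective, fun y => by simpa [Subtype.ext_iff] using h y,
    g.surjective_rangeRestrict⟩

lemma IsShortExact.inl_snd : IsShortExact (LinearMap.inl S N H) (LinearMap.snd S N H) :=
  ⟨LinearMap.inl_injective, Function.Exact.inl_snd, LinearMap.snd_surjective⟩

lemma IsShortExact.precomp {f : N →ₗ[S] E} {g : E →ₗ[S] H} (h : IsShortExact f g)
    (e : K ≃ₗ[S] N) : IsShortExact (f ∘ₗ e.toLinearMap) g :=
  ⟨h.injective.comp e.injective, (e.surjective.comp_exact_iff_exact).2 h.exact, h.surjective⟩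

lemma exists_comp_eq_of_exact {f : N →ₗ[S] E} {g : E →ₗ[S] H} (h : Function.Exact f g)
    (hg : Function.Surjective g) {k : E →ₗ[S] Q} (hk : k ∘ₗ f = 0) :
    ∃ l : H →ₗ[S] Q, l ∘ₗ g = k := by
  refine ⟨(LinearMap.range f).liftQ k (LinearMap.range_le_ker_iff.2 hk) ∘ₗ
    (h.linearEquivOfSurjective hg).symm.toLinearMap, LinearMap.ext fun x => ?_⟩
  have hx : (h.linearEquivOfSurjective hg).symm (g x) = (LinearMap.range f).mkQ x :=
    (LinearEquiv.symm_apply_eq _).2 rfl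
  simp [hx]

lemma exists_comp_eq_of_injective {f : N →ₗ[S] E} {g : E →ₗ[S] H} (hf : Function.Injective f)
    (h : Function.Exact f g) {k : Q →ₗ[S] E} (hk : g ∘ₗ k = 0) :
    ∃ l : Q →ₗ[S] N, f ∘ₗ l = k := by
  have hr (x : Q) : k x ∈ LinearMap.range f := (h (k x)).1 (LinearMap.congr_fun hk x)
  exact ⟨(LinearEquiv.ofInjective f hf).symm.toLinearMap ∘ₗ k.codRestrict _ hr,
    LinearMap.ext fun x => congrArg Subtype.val
      ((LinearEquiv.ofInjective f hf).apply_symm_apply ⟨k x, hr x⟩)⟩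

lemma IsShortExact.id_prodMap {f : N →ₗ[S] E} {g : E →ₗ[S] H} (h : IsShortExact f g) :
    IsShortExact ((LinearMap.id : K →ₗ[S] K).prodMap f) (g ∘ₗ LinearMap.snd S K E) where
  injective := Function.injective_id.prodMap h.injective
  exact := fun ⟨a, x⟩ => by simpa [Prod.ext_iff] using h.exact x
  surjective := h.surjective.comp LinearMap.snd_surjective

lemma IsShortExact.prodMap_id {f : N →ₗ[S] E} {g : E →ₗ[S] H} (h : IsShortExact f g) :
    IsShortExact (LinearMap.inl S E K ∘ₗ f) (g.prodMap (LinearMap.id : K →ₗ[S] K)) where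
  injective := LinearMap.inl_injective.comp h.injective
  exact := fun ⟨x, a⟩ => by
    simpa [Prod.ext_iff, eq_comm, and_comm] using fun _ => h.exact x
  surjective := h.surjective.prodMap Function.surjective_id

lemma IsShortExact.exists_prod_pushout {f : N →ₗ[S] E} {g : E →ₗ[S] H} (h : IsShortExact f g)
    {i : N →ₗ[S] P} {p : P →ₗ[S] Q} (hi : IsShortExact i p) {l : E →ₗ[S] P} (hl : l ∘ₗ f = i) :
    ∃ q : P × H →ₗ[S] Q, IsShortExact (l.prod g) q := by
  subst hl
  obtain ⟨d, hd⟩ := exists_comp_eq_of_exact h.exact h.surjective (k := p ∘ₗ l)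
    hi.exact.linearMap_comp_eq_zero
  replace hd (x : E) : d (g x) = p (l x) := LinearMap.congr_fun hd x
  refine ⟨p.coprod (-d), (injective_iff_map_eq_zero _).2 fun x hx => ?_, ?_, fun y => ?_⟩
  · obtain ⟨hlx, hgx⟩ := Prod.ext_iff.1 hx
    obtain ⟨n, rfl⟩ := (h.exact x).1 hgx
    rw [hi.injective (hlx.trans (map_zero _).symm), map_zero]
  · rintro ⟨x, y⟩
    obtain ⟨e, rfl⟩ := h.surjective y
    constructor
    · intro hx
      obtain ⟨n, hn⟩ := (hi.exact (x - l e)).1 (by simpa [hd, sub_eq_add_neg] using hx)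
      exact ⟨e + f n, by simp_all [h.exact.apply_apply_eq_zero]⟩
    · rintro ⟨e', he'⟩
      obtain ⟨rfl, he'⟩ := Prod.ext_iff.1 he'
      simp_all [← hd, ← he']
  · obtain ⟨x, rfl⟩ := hi.surjective y
    exact ⟨(x, 0), by simp⟩

lemma IsShortExact.exists_prod_pullback {f : N →ₗ[S] E} {g : E →ₗ[S] H} (h : IsShortExact f g)
    {j : L →ₗ[S] P} {q : P →ₗ[S] H} (hj : IsShortExact j q) {l : P →ₗ[S] E} (hl : g ∘ₗ l = q) :
    ∃ k : L →ₗ[S] N × P, IsShortExact k (f.coprod l) := by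
  subst hl
  obtain ⟨m, hm⟩ := exists_comp_eq_of_injective h.injective h.exact (k := l ∘ₗ j)
    hj.exact.linearMap_comp_eq_zero
  replace hm (x : L) : f (m x) = l (j x) := LinearMap.congr_fun hm x
  refine ⟨(-m).prod j, fun x y hxy => hj.injective (congrArg Prod.snd hxy), ?_, fun y => ?_⟩
  · rintro ⟨x, y⟩
    constructor
    · intro hxy
      obtain ⟨z, rfl⟩ := (hj.exact y).1 (by
        simpa [h.exact.apply_apply_eq_zero] using congrArg g hxy)
      refine ⟨z, Prod.ext (h.injective ?_) rfl⟩
      simpa [hm, neg_eq_iff_add_eq_zero, add_comm] using hxy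
    · rintro ⟨z, hz⟩
      obtain ⟨rfl, rfl⟩ := Prod.ext_iff.1 hz
      simp [hm]
  · obtain ⟨x, hx⟩ := hj.surjective (g y)
    obtain ⟨n, hn⟩ := (h.exact (y - l x)).1 (by rw [map_sub, ← hx, LinearMap.comp_apply, sub_self])
    exact ⟨(n, x), by simp [hn]⟩

lemma IsShortExact.exists_coker_comp {f : N →ₗ[S] E} {g : E →ₗ[S] H} (h : Function.Exact f g)
    (hg : Function.Surjective g) {i : E →ₗ[S] P} {p : P →ₗ[S] Q} (hi : IsShortExact i p) :
    ∃ (a : H →ₗ[S] P ⧸ LinearMap.range (i ∘ₗ f)) (b : (P ⧸ LinearMap.range (i ∘ₗ f)) →ₗ[S] Q),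
      IsShortExact a b := by
  have hc := LinearMap.exact_map_mkQ_range (i ∘ₗ f)
  have hc' := (LinearMap.range (i ∘ₗ f)).mkQ_surjective
  set c := (LinearMap.range (i ∘ₗ f)).mkQ
  obtain ⟨a, ha⟩ := exists_comp_eq_of_exact h hg (k := c ∘ₗ i) hc.linearMap_comp_eq_zero
  obtain ⟨b, rfl⟩ := exists_comp_eq_of_exact hc hc' (k := p) (by
    rw [← LinearMap.comp_assoc, hi.exact.linearMap_comp_eq_zero, LinearMap.zero_comp])
  replace ha (x : E) : a (g x) = c (i x) := LinearMap.congr_fun ha x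
  refine ⟨a, b, (injective_iff_map_eq_zero _).2 fun x hx => ?_, fun y => ?_,
    Function.Surjective.of_comp (g := c) hi.surjective⟩
  · obtain ⟨x, rfl⟩ := hg x
    obtain ⟨n, hn⟩ := (hc (i x)).1 ((ha x).symm.trans hx)
    exact (h x).2 ⟨n, hi.injective hn⟩
  · obtain ⟨y, rfl⟩ := hc' y
    constructor
    · intro hy
      obtain ⟨x, rfl⟩ := (hi.exact y).1 hy
      exact ⟨g x, ha x⟩
    · rintro ⟨x, hx⟩
      obtain ⟨x, rfl⟩ := hg x
      rw [← hx, ha]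
      exact hi.exact.apply_apply_eq_zero x

lemma IsShortExact.exists_ker_comp {f : N →ₗ[S] E} {g : E →ₗ[S] H} (h : IsShortExact f g)
    {i : K →ₗ[S] P} {p : P →ₗ[S] E} (hi : IsShortExact i p) :
    ∃ (a : K →ₗ[S] LinearMap.ker (g ∘ₗ p)) (b : LinearMap.ker (g ∘ₗ p) →ₗ[S] N),
      IsShortExact a b := by
  obtain ⟨b, hb⟩ := exists_comp_eq_of_injective h.injective h.exact
    (k := p ∘ₗ (LinearMap.ker (g ∘ₗ p)).subtype) (LinearMap.ext fun x => x.2)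
  replace hb (x : LinearMap.ker (g ∘ₗ p)) : f (b x) = p x := LinearMap.congr_fun hb x
  refine ⟨i.codRestrict _ fun x => by simp [hi.exact.apply_apply_eq_zero], b,
    fun x y hxy => hi.injective (congrArg Subtype.val hxy), fun x => ?_, fun n => ?_⟩
  · rw [← map_eq_zero_iff f h.injective, hb, hi.exact]
    simp [Subtype.ext_iff]
  · obtain ⟨x, hx⟩ := hi.surjective (f n)
    refine ⟨⟨x, by simp [hx, h.exact.apply_apply_eq_zero]⟩, h.injective ?_⟩
    rw [hb, hx]

end ShortExact

section LeftOrthogonal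

variable (S : Type u) [Ring S] {N E H : Type u} [AddCommGroup N] [Module S N]
  [AddCommGroup E] [Module S E] [AddCommGroup H] [Module S H]

/-- The modules `H` with `Ext^i(H, Q) = 0` for all `i ≥ 1` and all projective modules `Q`, that is,
the left orthogonal class of the projective modules. -/
def IsLeftOrthogonal (H : Type u) [AddCommGroup H] [Module S H] : Prop :=
  ∀ Q : ModuleCat.{u} S, Module.Projective S Q → ∀ i : ℕ,
    Subsingleton (Abelian.Ext.{u} (ModuleCat.of S H) Q (i + 1))

variable {S}

lemma IsShortExact.shortExact {f : N →ₗ[S] E} {g : E →ₗ[S] H} (h : IsShortExact f g) :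
    (ModuleCat.shortComplexOfCompEqZero f g h.exact.linearMap_comp_eq_zero).ShortExact :=
  ModuleCat.shortComplex_shortExact _ h.exact h.injective h.surjective

lemma IsLeftOrthogonal.of_projective [Module.Projective S H] : IsLeftOrthogonal S H := by
  have : Projective (ModuleCat.of S H) := (IsProjective.iff_projective H).1 inferInstance
  exact fun Q _ i => Abelian.Ext.subsingleton_of_projective _ Q i

lemma IsLeftOrthogonal.of_extension {f : N →ₗ[S] E} {g : E →ₗ[S] H} (h : IsShortExact f g)
    (hN : IsLeftOrthogonal S N) (hH : IsLeftOrthogonal S H) : IsLeftOrthogonal S E := by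
  intro Q hQ i
  have := hN Q hQ i
  have := hH Q hQ i
  refine subsingleton_of_forall_eq 0 fun x => ?_
  obtain ⟨y, rfl⟩ := Abelian.Ext.contravariant_sequence_exact₂ h.shortExact Q x (by subsingleton)
  rw [show y = 0 by subsingleton, Abelian.Ext.comp_zero]

lemma IsLeftOrthogonal.of_epi {f : N →ₗ[S] E} {g : E →ₗ[S] H} (h : IsShortExact f g)
    (hE : IsLeftOrthogonal S E) (hH : IsLeftOrthogonal S H) : IsLeftOrthogonal S N := by
  intro Q hQ i
  have := hE Q hQ i
  have := hH Q hQ (i + 1)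
  refine subsingleton_of_forall_eq 0 fun x => ?_
  obtain ⟨y, rfl⟩ := Abelian.Ext.contravariant_sequence_exact₁ h.shortExact Q x
    (add_comm 1 (i + 1)) (by subsingleton)
  rw [show y = 0 by subsingleton, Abelian.Ext.comp_zero]

lemma IsLeftOrthogonal.exists_extend {f : N →ₗ[S] E} {g : E →ₗ[S] H} (h : IsShortExact f g)
    (hH : IsLeftOrthogonal S H) {Q : Type u} [AddCommGroup Q] [Module S Q]
    [hQ : Module.Projective S Q] (k : N →ₗ[S] Q) : ∃ l : E →ₗ[S] Q, l ∘ₗ f = k := by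
  have := hH (ModuleCat.of S Q) hQ 0
  obtain ⟨y, hy⟩ := Abelian.Ext.contravariant_sequence_exact₁ h.shortExact (ModuleCat.of S Q)
    (Abelian.Ext.mk₀ (ModuleCat.ofHom k)) (add_comm 1 0) (by subsingleton)
  obtain ⟨l, rfl⟩ := (Abelian.Ext.mk₀_bijective _ _).2 y
  rw [Abelian.Ext.mk₀_comp_mk₀] at hy
  exact ⟨l.hom, congrArg ModuleCat.Hom.hom ((Abelian.Ext.mk₀_bijective _ _).1 hy)⟩

lemma subsingleton_ext_one_of_exists_extend [Module.Projective S E] {f : N →ₗ[S] E}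
    {g : E →ₗ[S] H} (h : IsShortExact f g) {Q : ModuleCat.{u} S}
    (hQ : ∀ k : N →ₗ[S] Q, ∃ l : E →ₗ[S] Q, l ∘ₗ f = k) :
    Subsingleton (Abelian.Ext.{u} (ModuleCat.of S H) Q 1) := by
  have : Projective (ModuleCat.of S E) := (IsProjective.iff_projective E).1 inferInstance
  refine subsingleton_of_forall_eq 0 fun x => ?_
  obtain ⟨y, rfl⟩ := precomp_extClass_surjective_of_projective_X₂ Q h.shortExact 0 x
  obtain ⟨k, rfl⟩ := (Abelian.Ext.mk₀_bijective _ _).2 y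
  obtain ⟨l, hl⟩ := hQ k.hom
  obtain rfl : ModuleCat.ofHom f ≫ ModuleCat.ofHom l = k := ModuleCat.hom_ext hl
  rw [← Abelian.Ext.mk₀_comp_mk₀]
  exact h.shortExact.extClass_comp_assoc _ (h := add_comm 1 0)

lemma subsingleton_ext_succ [Module.Projective S E] {f : N →ₗ[S] E} {g : E →ₗ[S] H}
    (h : IsShortExact f g) (Q : ModuleCat.{u} S) (i : ℕ)
    [Subsingleton (Abelian.Ext.{u} (ModuleCat.of S N) Q i)] :
    Subsingleton (Abelian.Ext.{u} (ModuleCat.of S H) Q (i + 1)) := by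
  have : Projective (ModuleCat.of S E) := (IsProjective.iff_projective E).1 inferInstance
  exact (precomp_extClass_surjective_of_projective_X₂ Q h.shortExact i).subsingleton

lemma IsLeftOrthogonal.of_forall_syzygy {W : ModuleCat.{u} S → Prop}
    (hW : ∀ X, W X → ∃ (K P : ModuleCat.{u} S) (f : K →ₗ[S] P) (g : P →ₗ[S] X),
      Module.Projective S P ∧ IsShortExact f g ∧ W K ∧
      ∀ Q : ModuleCat.{u} S, Module.Projective S Q → ∀ k : K →ₗ[S] Q,
        ∃ l : P →ₗ[S] Q, l ∘ₗ f = k)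
    {X : ModuleCat.{u} S} (hX : W X) : IsLeftOrthogonal S X := by
  intro Q hQ i
  induction i generalizing X with
  | zero =>
    obtain ⟨K, P, f, g, hP, h, -, hl⟩ := hW X hX
    exact subsingleton_ext_one_of_exists_extend h (hl Q hQ)
  | succ i ih =>
    obtain ⟨K, P, f, g, hP, h, hK, -⟩ := hW X hX
    have := ih hK
    exact subsingleton_ext_succ h Q (i + 1)

variable (T D : Type u) [Ring T] [AddCommGroup D] [Module S D] [Module T D] [SMulCommClass S T D]

lemma IsLeftOrthogonal.nonempty_extEquiv [hD : Module.Projective S D] {f : N →ₗ[S] E}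
    {g : E →ₗ[S] H} (h : IsShortExact f g) (hH : IsLeftOrthogonal S H) {i : ℕ} (hi : 1 ≤ i) :
    Nonempty (ExtD S D E i ≃ₗ[T] ExtD S D N i) := by
  obtain ⟨i, rfl⟩ := Nat.exists_eq_add_of_le' hi
  have := hH (ModuleCat.of S D) hD i
  have := hH (ModuleCat.of S D) hD (i + 1)
  let φ : ExtD S D E (i + 1) →ₗ[T] ExtD S D N (i + 1) :=
    { toFun := fun x => (Abelian.Ext.mk₀ (ModuleCat.ofHom f)).comp x (zero_add _)
      map_add' := fun x y => Abelian.Ext.comp_add _ _ _ _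
      map_smul' := fun t x => (Abelian.Ext.comp_assoc _ x
        (Abelian.Ext.mk₀ (mulHom S T D t)) (zero_add _) (add_zero _) (by simp)).symm }
  refine ⟨LinearEquiv.ofBijective φ ⟨(injective_iff_map_eq_zero _).2 fun x hx => ?_, fun x => ?_⟩⟩
  · obtain ⟨y, rfl⟩ := Abelian.Ext.contravariant_sequence_exact₂ h.shortExact _ x hx
    rw [show y = 0 by subsingleton]
    exact Abelian.Ext.comp_zero (Abelian.Ext.mk₀ (ModuleCat.ofHom g)) ..
  · exact Abelian.Ext.contravariant_sequence_exact₁ h.shortExact (ModuleCat.of S D) x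
      (add_comm 1 (i + 1)) (by subsingleton)

end LeftOrthogonal

section GorensteinProjective

variable {S : Type u} [Ring S] {N E H : Type u} [AddCommGroup N] [Module S N]
  [AddCommGroup E] [Module S E] [AddCommGroup H] [Module S H]

/-- Classes `W` of modules contained in the left orthogonal class of the projective modules such
that every member of `W` embeds into a projective module with cokernel in `W`. The Gorenstein
projective modules form the largest such class, so they can be recognised without writing down
complete resolutions. -/
def IsGorensteinClass (W : ModuleCat.{u} S → Prop) : Prop :=
  ∀ X, W X → IsLeftOrthogonal S X ∧ ∃ (P Y : ModuleCat.{u} S) (f : X →ₗ[S] P) (g : P →ₗ[S] Y),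
    Module.Projective S P ∧ IsShortExact f g ∧ W Y

lemma IsGorensteinClass.insert {W : ModuleCat.{u} S → Prop} (hW : IsGorensteinClass W)
    {K P X : ModuleCat.{u} S} (hP : Module.Projective S P) {f : K →ₗ[S] P} {g : P →ₗ[S] X}
    (h : IsShortExact f g) (hX : W X) : IsGorensteinClass fun Z => Z = K ∨ W Z := by
  rintro Z (rfl | hZ)
  · exact ⟨.of_epi h .of_projective (hW X hX).1, P, X, f, g, hP, h, .inr hX⟩
  · obtain ⟨hZ, P, Y, f, g, hP, h, hY⟩ := hW Z hZ
    exact ⟨hZ, P, Y, f, g, hP, h, .inr hY⟩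

/-- The union of all Gorenstein classes. -/
def InGorensteinClass (X : ModuleCat.{u} S) : Prop :=
  ∃ W : ModuleCat.{u} S → Prop, IsGorensteinClass W ∧ W X

lemma InGorensteinClass.isGorensteinClass : IsGorensteinClass (InGorensteinClass (S := S)) := by
  rintro X ⟨W, hW, hX⟩
  obtain ⟨h, P, Y, f, g, hP, hfg, hY⟩ := hW X hX
  exact ⟨h, P, Y, f, g, hP, hfg, W, hW, hY⟩

lemma InGorensteinClass.exists_cover {X : ModuleCat.{u} S} (hX : InGorensteinClass X) :
    ∃ (K P : ModuleCat.{u} S) (f : K →ₗ[S] P) (g : P →ₗ[S] X),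
      Module.Projective S P ∧ IsShortExact f g ∧ InGorensteinClass K := by
  have hP : Module.Projective S (ModuleCat.of S (X →₀ S)) :=
    inferInstanceAs (Module.Projective S (X →₀ S))
  have h := IsShortExact.ker_subtype (Finsupp.linearCombination_id_surjective S X)
  exact ⟨.of S (LinearMap.ker (Finsupp.linearCombination S (id : X → X))), .of S (X →₀ S), _, _,
    hP, h, _, InGorensteinClass.isGorensteinClass.insert hP h hX, .inl rfl⟩

lemma exists_int_chain {W : Type*} {r : W → W → Prop} (hl : ∀ w, ∃ w', r w' w)
    (hr : ∀ w, ∃ w', r w w') (w : W) : ∃ z : ℤ → W, z 1 = w ∧ ∀ i, r (z (i + 1)) (z i) := by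
  choose f hf using hl
  choose g hg using hr
  let z : ℤ → W := Int.rec (fun n => f^[n] w) (fun n => g^[n + 1] w)
  have hz : ∀ i, r (z (i + 1)) (z i) := by
    rintro (n | _ | n)
    · change r (f^[n + 1] w) (f^[n] w)
      exact Function.iterate_succ_apply' f n w ▸ hf _
    · exact hg w
    · change r (g^[n + 1] w) (g^[n + 1 + 1] w)
      exact Function.iterate_succ_apply' g (n + 1) w ▸ hg _
  exact ⟨fun i => z (i - 1), rfl, fun i => by simpa using hz (i - 1)⟩

lemma IsGorensteinProjective.of_forall_isShortExact {Z P : ℤ → ModuleCat.{u} S}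
    (hZ : ∀ i, IsLeftOrthogonal S (Z i)) (hP : ∀ i, Module.Projective S (P i))
    {f : ∀ i, Z (i + 1) →ₗ[S] P i} {g : ∀ i, P i →ₗ[S] Z i}
    (h : ∀ i, IsShortExact (f i) (g i)) : IsGorensteinProjective S (Z 1) := by
  refine ⟨P, fun i => f i ∘ₗ g (i + 1), hP, fun i => ?_, fun Q hQ i k => ⟨fun hk => ?_, ?_⟩, ?_⟩
  · refine (h (i + 1 + 1)).surjective.comp_exact_iff_exact.2 ?_
    exact (h i).injective.comp_exact_iff_exact.2 (h (i + 1)).exact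
  · obtain ⟨l, rfl⟩ := exists_comp_eq_of_exact (h (i + 1)).exact (h (i + 1)).surjective (k := k)
      ((LinearMap.cancel_right (h (i + 1 + 1)).surjective).1 hk)
    obtain ⟨m, rfl⟩ := (hZ i).exists_extend (h i) l
    exact ⟨m, rfl⟩
  · rintro ⟨l, rfl⟩
    ext x
    simp [(h (i + 1)).exact.apply_apply_eq_zero]
  · have hr : LinearMap.range (f 0) = LinearMap.range (f 0 ∘ₗ g (0 + 1)) :=
      (LinearMap.range_comp_of_range_eq_top _
        (LinearMap.range_eq_top.2 (h (0 + 1)).surjective)).symm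
    exact ⟨(LinearEquiv.ofInjective (f 0) (h 0).injective).trans (LinearEquiv.ofEq _ _ hr)⟩

lemma InGorensteinClass.isGorensteinProjective {X : ModuleCat.{u} S}
    (hX : InGorensteinClass X) : IsGorensteinProjective S X := by
  obtain ⟨z, hz, hr⟩ := exists_int_chain (W := {Y : ModuleCat.{u} S // InGorensteinClass Y})
    (r := fun K Y => ∃ (P : ModuleCat.{u} S) (f : K.1 →ₗ[S] P) (g : P →ₗ[S] Y.1),
      Module.Projective S P ∧ IsShortExact f g)
    (fun Y => by
      obtain ⟨K, P, f, g, hP, h, hK⟩ := Y.2.exists_cover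
      exact ⟨⟨K, hK⟩, P, f, g, hP, h⟩)
    (fun K => by
      obtain ⟨-, P, Y, f, g, hP, h, hY⟩ := InGorensteinClass.isGorensteinClass K.1 K.2
      exact ⟨⟨Y, hY⟩, P, f, g, hP, h⟩) ⟨X, hX⟩
  choose P f g hP h using hr
  have hZ (i : ℤ) : IsLeftOrthogonal S (z i).1 :=
    (InGorensteinClass.isGorensteinClass _ (z i).2).1
  have := IsGorensteinProjective.of_forall_isShortExact (Z := fun i => (z i).1) hZ hP h
  rwa [hz] at this

lemma isGorensteinClass_range {P : ℤ → ModuleCat.{u} S} {d : ∀ i, P (i + 1) →ₗ[S] P i}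
    (hP : ∀ i, Module.Projective S (P i)) (hd : ∀ i, Function.Exact (d (i + 1)) (d i))
    (hQ : ∀ Q : ModuleCat.{u} S, Module.Projective S Q → ∀ i : ℤ,
      Function.Exact (fun h : P i →ₗ[S] Q => h ∘ₗ d i)
        (fun h : P (i + 1) →ₗ[S] Q => h ∘ₗ d (i + 1))) :
    IsGorensteinClass fun X => ∃ i, X = ModuleCat.of S (LinearMap.range (d i)) := by
  have hd' (i : ℤ) := IsShortExact.range_subtype_rangeRestrict (hd i)
  have hext (i : ℤ) (Q : ModuleCat.{u} S) (hQ' : Module.Projective S Q)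
      (k : LinearMap.range (d i) →ₗ[S] Q) :
      ∃ l : P i →ₗ[S] Q, l ∘ₗ (LinearMap.range (d i)).subtype = k := by
    have hk : (k ∘ₗ (d i).rangeRestrict) ∘ₗ d (i + 1) = 0 := LinearMap.ext fun x => by
      rw [LinearMap.comp_apply, LinearMap.comp_apply, show (d i).rangeRestrict (d (i + 1) x) = 0
        from Subtype.ext ((hd i).apply_apply_eq_zero x), map_zero, LinearMap.zero_apply]
    obtain ⟨l, hl⟩ := (hQ Q hQ' i _).1 hk
    exact ⟨l, (LinearMap.cancel_right (d i).surjective_rangeRestrict).1 hl⟩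
  rintro _ ⟨i, rfl⟩
  refine ⟨.of_forall_syzygy (W := fun X => ∃ i, X = ModuleCat.of S (LinearMap.range (d i)))
    ?_ ⟨i, rfl⟩, ?_⟩
  · rintro _ ⟨i, rfl⟩
    exact ⟨.of S (LinearMap.range (d (i + 1))), P (i + 1), _, _, hP _, hd' i, ⟨i + 1, rfl⟩,
      hext (i + 1)⟩
  · obtain ⟨j, rfl⟩ : ∃ j, i = j + 1 := ⟨i - 1, by simp⟩
    exact ⟨P (j + 1), .of S (LinearMap.range (d j)), _, _, hP _, hd' j, j, rfl⟩

lemma IsGorensteinProjective.inGorensteinClass (hE : IsGorensteinProjective S E) :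
    InGorensteinClass (ModuleCat.of S E) := by
  obtain ⟨P, d, hP, hd, hQ, ⟨e⟩⟩ := hE
  have h := (IsShortExact.range_subtype_rangeRestrict (hd (-1))).precomp e
  exact ⟨_, (isGorensteinClass_range hP hd hQ).insert (K := .of S E)
    (X := .of S (LinearMap.range (d (-1)))) (hP 0) h ⟨-1, rfl⟩, .inl rfl⟩

lemma IsGorensteinProjective.isLeftOrthogonal (hE : IsGorensteinProjective S E) :
    IsLeftOrthogonal S E :=
  (InGorensteinClass.isGorensteinClass _ hE.inGorensteinClass).1

lemma IsGorensteinProjective.of_projective [Module.Projective S E] :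
    IsGorensteinProjective S E := by
  have hW : IsGorensteinClass fun X : ModuleCat.{u} S => Module.Projective S X := fun X hX =>
    ⟨.of_projective, .of S (X × X), X, _, _, inferInstanceAs (Module.Projective S (X × X)),
      .inl_snd, hX⟩
  exact InGorensteinClass.isGorensteinProjective (X := .of S E) ⟨_, hW, ‹_›⟩

lemma IsGorensteinProjective.congr (e : N ≃ₗ[S] E) (hE : IsGorensteinProjective S E) :
    IsGorensteinProjective S N := by
  obtain ⟨P, d, hP, hd, hQ, ⟨e'⟩⟩ := hE
  exact ⟨P, d, hP, hd, hQ, ⟨e.trans e'⟩⟩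

/-- `N` is isomorphic to a submodule of `E` whose quotient is Gorenstein projective. -/
def GorensteinEmbeds (S N E : Type u) [Ring S] [AddCommGroup N] [Module S N] [AddCommGroup E]
    [Module S E] : Prop :=
  ∃ (H : ModuleCat.{u} S) (f : N →ₗ[S] E) (g : E →ₗ[S] H),
    IsShortExact f g ∧ IsGorensteinProjective S H

lemma IsGorensteinProjective.exists_gorensteinEmbeds (hE : IsGorensteinProjective S E) :
    ∃ P : ModuleCat.{u} S, Module.Projective S P ∧ GorensteinEmbeds S E P := by
  obtain ⟨-, P, Y, f, g, hP, h, hY⟩ := InGorensteinClass.isGorensteinClass _ hE.inGorensteinClass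
  exact ⟨P, hP, Y, f, g, h, hY.isGorensteinProjective⟩

lemma IsGorensteinProjective.of_extension {f : N →ₗ[S] E} {g : E →ₗ[S] H} (h : IsShortExact f g)
    (hN : IsGorensteinProjective S N) (hH : IsGorensteinProjective S H) :
    IsGorensteinProjective S E := by
  have hW : IsGorensteinClass fun X : ModuleCat.{u} S => ∃ (N H : ModuleCat.{u} S)
      (f : N →ₗ[S] X) (g : X →ₗ[S] H), IsShortExact f g ∧
        IsGorensteinProjective S N ∧ IsGorensteinProjective S H := by
    rintro X ⟨N, H, f, g, h, hN, hH⟩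
    refine ⟨.of_extension h hN.isLeftOrthogonal hH.isLeftOrthogonal, ?_⟩
    obtain ⟨P, hP, N', i, p, hi, hN'⟩ := hN.exists_gorensteinEmbeds
    obtain ⟨Q, hQ, H', j, q, hj, hH'⟩ := hH.exists_gorensteinEmbeds
    obtain ⟨l, hl⟩ := hH.isLeftOrthogonal.exists_extend h i
    obtain ⟨r, hr⟩ := h.exists_prod_pushout hi hl
    have hj := hj.id_prodMap (K := P)
    have hc := IsShortExact.range_mkQ (f := LinearMap.id.prodMap j ∘ₗ l.prod g)
      (hj.injective.comp hr.injective)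
    obtain ⟨a, b, hab⟩ := IsShortExact.exists_coker_comp hr.exact hr.surjective hj
    exact ⟨.of S (P × Q), .of S _, _, _, inferInstanceAs (Module.Projective S (P × Q)), hc,
      N', H', a, b, hab, hN', hH'⟩
  exact InGorensteinClass.isGorensteinProjective (X := .of S E)
    ⟨_, hW, .of S N, .of S H, f, g, h, hN, hH⟩

lemma IsGorensteinProjective.prod (hN : IsGorensteinProjective S N)
    (hH : IsGorensteinProjective S H) : IsGorensteinProjective S (N × H) :=
  .of_extension .inl_snd hN hH

lemma IsGorensteinProjective.of_epi {f : N →ₗ[S] E} {g : E →ₗ[S] H} (h : IsShortExact f g)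
    (hE : IsGorensteinProjective S E) (hH : IsGorensteinProjective S H) :
    IsGorensteinProjective S N := by
  obtain ⟨P, hP, Y, i, p, hi, hY⟩ := hE.exists_gorensteinEmbeds
  have hc := IsShortExact.range_mkQ (f := i ∘ₗ f) (hi.injective.comp h.injective)
  obtain ⟨a, b, hab⟩ := IsShortExact.exists_coker_comp h.exact h.surjective hi
  have hC := IsGorensteinProjective.of_extension hab hH hY
  exact InGorensteinClass.isGorensteinProjective (X := .of S N)
    ⟨_, InGorensteinClass.isGorensteinClass.insert (K := .of S N) (X := .of S _) hP hc
      hC.inGorensteinClass, .inl rfl⟩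

end GorensteinProjective

section Dimension

variable {S : Type u} [Ring S] {N E H M : Type u} [AddCommGroup N] [Module S N]
  [AddCommGroup E] [Module S E] [AddCommGroup H] [Module S H] [AddCommGroup M] [Module S M]

lemma hasGorensteinResolution_zero_iff :
    HasGorensteinResolution S 0 M ↔ IsGorensteinProjective S M := by
  constructor
  · rintro ⟨G, d, ε, hG, hG₀, -, hε, hs⟩
    have := hG₀ 1 one_pos
    have hd : d 0 = 0 := LinearMap.ext fun x => by
      rw [show x = 0 from Subsingleton.elim (α := G 1) x 0, map_zero, map_zero]
    rw [hd] at hε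
    exact (hG 0 le_rfl).congr
      (LinearEquiv.ofBijective ε ⟨(LinearMap.exact_zero_iff_injective _ ε).1 hε, hs⟩).symm
  · intro hM
    refine ⟨fun i => i.casesOn (.of S M) fun _ => .of S PUnit.{u + 1}, fun _ => 0, LinearMap.id,
      ?_, ?_, fun _ _ => ?_, (LinearMap.exact_zero_iff_injective _ _).2 Function.injective_id,
      Function.surjective_id⟩
    · rintro (_ | i) hi
      · exact hM
      · exact absurd hi i.not_succ_le_zero
    · rintro (_ | i) hi
      · exact absurd hi (lt_irrefl 0)
      · exact inferInstanceAs (Subsingleton PUnit)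
    · exact ⟨fun _ => ⟨0, Subsingleton.elim (α := PUnit) _ _⟩, fun _ => rfl⟩

lemma hasGorensteinResolution_succ_iff {n : ℕ} :
    HasGorensteinResolution S (n + 1) M ↔
      ∃ (K G : ModuleCat.{u} S) (f : K →ₗ[S] G) (g : G →ₗ[S] M),
        IsShortExact f g ∧ IsGorensteinProjective S G ∧ HasGorensteinResolution S n K := by
  constructor
  · rintro ⟨G, d, ε, hG, hG₀, hd, hε, hs⟩
    have h := IsShortExact.ker_subtype hs
    obtain ⟨δ, hδ⟩ := exists_comp_eq_of_injective h.injective h.exact hε.linearMap_comp_eq_zero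
    refine ⟨.of S (LinearMap.ker ε), G 0, _, ε, h, hG 0 n.succ.zero_le, fun i => G (i + 1),
      fun i => d (i + 1), δ, fun i hi => hG _ (by lia), fun i hi => hG₀ _ (by lia),
      fun i => hd _, ?_, ?_⟩
    · exact h.injective.comp_exact_iff_exact.1 (by simpa only [← hδ] using hd 0)
    · rintro ⟨y, hy⟩
      obtain ⟨x, rfl⟩ := (hε y).1 hy
      exact ⟨x, Subtype.ext (LinearMap.congr_fun hδ x)⟩
  · rintro ⟨K, G₀, f, g, h, hG₀, G, d, ε, hG, hG', hd, hε, hs⟩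
    refine ⟨fun i => i.casesOn G₀ G, fun i => i.casesOn (f ∘ₗ ε) d, g, ?_, ?_, ?_,
      hs.comp_exact_iff_exact.2 h.exact, h.surjective⟩
    · rintro (_ | i) hi
      · exact hG₀
      · exact hG i (by lia)
    · rintro (_ | i) hi
      · exact absurd hi (by lia)
      · exact hG' i (by lia)
    · rintro (_ | i)
      · exact h.injective.comp_exact_iff_exact.2 hε
      · exact hd i

lemma HasGorensteinResolution.of_epi {n : ℕ} {f : N →ₗ[S] E} {g : E →ₗ[S] H}
    (h : IsShortExact f g) (hH : IsGorensteinProjective S H)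
    (hE : HasGorensteinResolution S n E) : HasGorensteinResolution S n N := by
  rcases n with _ | n
  · rw [hasGorensteinResolution_zero_iff] at hE ⊢
    exact .of_epi h hE hH
  · rw [hasGorensteinResolution_succ_iff] at hE ⊢
    obtain ⟨K, G, i, p, hi, hG, hK⟩ := hE
    obtain ⟨a, b, hab⟩ := h.exists_ker_comp hi
    exact ⟨K, .of S (LinearMap.ker (g ∘ₗ p)), a, b, hab,
      .of_epi (.ker_subtype (h.surjective.comp hi.surjective)) hG hH, hK⟩

lemma HasGorensteinResolution.of_extension {n : ℕ} {f : N →ₗ[S] E} {g : E →ₗ[S] H}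
    (h : IsShortExact f g) (hN : HasGorensteinResolution S n N)
    (hH : IsGorensteinProjective S H) : HasGorensteinResolution S n E := by
  induction n generalizing N E H with
  | zero =>
    rw [hasGorensteinResolution_zero_iff] at hN ⊢
    exact .of_extension h hN hH
  | succ n ih =>
    rw [hasGorensteinResolution_succ_iff] at hN ⊢
    obtain ⟨K, G, i, p, hi, hG, hK⟩ := hN
    obtain ⟨L, P, j, q, hP, hj, hL⟩ := hH.inGorensteinClass.exists_cover
    obtain ⟨l, hl⟩ := Module.projective_lifting_property g q h.surjective
    obtain ⟨k, hk⟩ := h.exists_prod_pullback hj hl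
    have hi := hi.prodMap_id (K := P)
    obtain ⟨a, b, hab⟩ := hk.exists_ker_comp hi
    exact ⟨.of S (LinearMap.ker (f.coprod l ∘ₗ p.prodMap LinearMap.id)), .of S (G × P), _, _,
      .ker_subtype (hk.surjective.comp hi.surjective), hG.prod .of_projective,
      ih hab hK hL.isGorensteinProjective⟩

lemma GorensteinEmbeds.gpd_eq (h : GorensteinEmbeds S N E) : Gpd S N = Gpd S E := by
  obtain ⟨H, f, g, h, hH⟩ := h
  have hiff (n : ℕ) : HasGorensteinResolution S n N ↔ HasGorensteinResolution S n E :=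
    ⟨fun hN => .of_extension h hN hH, .of_epi h hH⟩
  simp only [Gpd, hiff]

end Dimension

section FinitelyGenerated

lemma exists_factor_finite_free {S K Q : Type*} [Ring S] [AddCommGroup K] [Module S K]
    [Module.Finite S K] [AddCommGroup Q] [Module S Q] [Module.Projective S Q] (h : K →ₗ[S] Q) :
    ∃ (n : ℕ) (a : Q →ₗ[S] (Fin n → S)) (b : (Fin n → S) →ₗ[S] Q), b ∘ₗ a ∘ₗ h = h := by
  classical
  obtain ⟨σ, hσ⟩ := (Module.projective_def' (R := S) (P := Q)).1 inferInstance
  obtain ⟨m, v, hv⟩ := Module.Finite.exists_fin (R := S) (M := K)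
  let s : Finset Q := Finset.univ.biUnion fun j => (σ (h (v j))).support
  let a : Q →ₗ[S] (s → S) := LinearMap.pi fun i => Finsupp.lapply i.1 ∘ₗ σ
  let b : (s → S) →ₗ[S] Q := Fintype.linearCombination S Subtype.val
  let e := LinearEquiv.funCongrLeft S S s.equivFin
  refine ⟨s.card, e.symm.toLinearMap ∘ₗ a, b ∘ₗ e.toLinearMap,
    LinearMap.ext_on_range hv fun j => ?_⟩
  have hs : (σ (h (v j))).support ⊆ s :=
    Finset.subset_biUnion_of_mem (fun j => (σ (h (v j))).support) (Finset.mem_univ j)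
  calc b (e (e.symm (a (h (v j))))) = ∑ i : s, σ (h (v j)) i.1 • i.1 := by
        rw [e.apply_symm_apply]; rfl
    _ = ∑ i ∈ s, σ (h (v j)) i • i := Finset.sum_coe_sort s fun i => σ (h (v j)) i • i
    _ = Finsupp.linearCombination S id (σ (h (v j))) :=
        (Finsupp.sum_of_support_subset _ hs (fun i r => r • i) fun i _ => zero_smul S i).symm
    _ = h (v j) := LinearMap.congr_fun hσ _

lemma IsGorensteinProjective.exists_finite_free_embedding {S X : Type u} [Ring S]
    [AddCommGroup X] [Module S X] [Module.Finite S X] (hX : IsGorensteinProjective S X) :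
    ∃ n : ℕ, GorensteinEmbeds S X (Fin n → S) := by
  obtain ⟨P, hP, H, j, p, hj, hH⟩ := hX.exists_gorensteinEmbeds
  obtain ⟨n, a, b, hab⟩ := exists_factor_finite_free j
  have hinj : Function.Injective (b ∘ₗ a ∘ₗ j) := by rw [hab]; exact hj.injective
  have hc := IsShortExact.range_mkQ (f := a ∘ₗ j) (.of_comp (f := b) hinj)
  -- With `C` the cokernel of `X → S^n`, this is `0 → S^n → P × C → H → 0`.
  obtain ⟨q, hq⟩ := hc.exists_prod_pushout hj hab
  have hPC := IsGorensteinProjective.of_extension hq .of_projective hH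
  exact ⟨n, .of S ((Fin n → S) ⧸ LinearMap.range (a ∘ₗ j)), _, _, hc,
    .of_epi .inl_snd (hPC.congr (LinearEquiv.prodComm S _ _)) .of_projective⟩

end FinitelyGenerated

section Coherent

/-- Left coherent rings: the finitely generated left ideals are finitely presented. -/
class IsCoherentRing (S : Type*) [Ring S] : Prop where
  finitePresentation_of_fg : ∀ I : Ideal S, I.FG → Module.FinitePresentation S I

instance {S : Type*} [Ring S] [IsNoetherianRing S] : IsCoherentRing S where
  finitePresentation_of_fg I _ := Module.finitePresentation_of_finite S I

lemma finitePresentation_of_injective {S : Type*} [Ring S] [IsCoherentRing S] {n : ℕ} {X : Type*}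
    [AddCommGroup X] [Module S X] [Module.Finite S X] {f : X →ₗ[S] (Fin n → S)}
    (hf : Function.Injective f) : Module.FinitePresentation S X := by
  induction n generalizing X with
  | zero =>
    have := hf.subsingleton
    infer_instance
  | succ n ih =>
    let φ : X →ₗ[S] S := LinearMap.proj 0 ∘ₗ f
    have hφ := φ.surjective_rangeRestrict
    have : Module.FinitePresentation S (LinearMap.range φ) :=
      IsCoherentRing.finitePresentation_of_fg _ (Module.Finite.iff_fg.1 inferInstance)
    have : Module.Finite S (LinearMap.ker φ.rangeRestrict) :=
      .of_fg (Module.FinitePresentation.fg_ker _ hφ)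
    let tail : LinearMap.ker φ.rangeRestrict →ₗ[S] (Fin n → S) :=
      LinearMap.funLeft S S Fin.succ ∘ₗ f ∘ₗ (LinearMap.ker φ.rangeRestrict).subtype
    have htail : Function.Injective tail := fun x y hxy => by
      have hx : f x 0 = 0 := congrArg Subtype.val x.2
      have hy : f y 0 = 0 := congrArg Subtype.val y.2
      exact Subtype.ext (hf (funext (Fin.cases (hx.trans hy.symm) (congrFun hxy))))
    have := ih htail
    exact Module.finitePresentation_of_ker φ.rangeRestrict hφ

variable {S : Type u} [Ring S] [IsCoherentRing S] {X Y : Type u} [AddCommGroup X] [Module S X]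
  [AddCommGroup Y] [Module S Y] [Module.Finite S X] [Module.Finite S Y]

lemma IsGorensteinProjective.finitePresentation (hX : IsGorensteinProjective S X) :
    Module.FinitePresentation S X := by
  obtain ⟨n, C, f, g, h, -⟩ := hX.exists_finite_free_embedding
  exact finitePresentation_of_injective h.injective

lemma IsGorensteinProjective.finite_ker (hY : IsGorensteinProjective S Y) {g : X →ₗ[S] Y}
    (hg : Function.Surjective g) : Module.Finite S (LinearMap.ker g) := by
  have := hY.finitePresentation
  exact .of_fg (Module.FinitePresentation.fg_ker g hg)

end Coherent

section Duality

variable {S T D : Type u} [Ring S] [Ring T] [AddCommGroup D] [Module S D] [Module T D]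
  [SMulCommClass S T D] {X Y Z : Type u} [AddCommGroup X] [Module S X] [AddCommGroup Y]
  [Module S Y] [AddCommGroup Z] [Module S Z]

@[simp]
lemma dualMap_apply (f : X →ₗ[S] Y) (h : Y →ₗ[S] D) : dualMap S T D f h = h ∘ₗ f :=
  rfl

lemma IsShortExact.dual [Module.Projective S D] {f : X →ₗ[S] Y} {g : Y →ₗ[S] Z}
    (h : IsShortExact f g) (hZ : IsLeftOrthogonal S Z) :
    IsShortExact (dualMap S T D g) (dualMap S T D f) := by
  refine ⟨fun _ _ => (LinearMap.cancel_right h.surjective).1,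
    fun k => ⟨exists_comp_eq_of_exact h.exact h.surjective, ?_⟩, hZ.exists_extend h⟩
  rintro ⟨l, rfl⟩
  rw [dualMap_apply, dualMap_apply, LinearMap.comp_assoc, h.exact.linearMap_comp_eq_zero,
    LinearMap.comp_zero]

variable (S T D) in
/-- The isomorphism `D^n ≃ Hom(S^n, D)`. -/
noncomputable def dualFreeEquiv (n : ℕ) : (Fin n → D) ≃ₗ[T] ((Fin n → S) →ₗ[S] D) :=
  (Pi.basisFun S (Fin n)).constr T

lemma dualFreeEquiv_apply {n : ℕ} (d : Fin n → D) (x : Fin n → S) :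
    dualFreeEquiv S T D n d x = ∑ i, x i • d i := by
  simp [dualFreeEquiv, Module.Basis.constr_apply_fintype]

lemma exists_extend_of_factor {Q : Type*} [AddCommGroup Q] [Module S Q] {f : X →ₗ[S] Y}
    (hf : ∀ k : X →ₗ[S] Q, ∃ l : Y →ₗ[S] Q, l ∘ₗ f = k) {n : ℕ} {k : X →ₗ[S] Z}
    {a : Z →ₗ[S] (Fin n → Q)} {b : (Fin n → Q) →ₗ[S] Z} (hk : b ∘ₗ a ∘ₗ k = k) :
    ∃ l : Y →ₗ[S] Z, l ∘ₗ f = k := by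
  choose l hl using fun i => hf (LinearMap.proj i ∘ₗ a ∘ₗ k)
  have hpi : LinearMap.pi l ∘ₗ f = a ∘ₗ k :=
    LinearMap.ext fun x => funext fun i => LinearMap.congr_fun (hl i) x
  exact ⟨b ∘ₗ LinearMap.pi l, by rw [LinearMap.comp_assoc, hpi, hk]⟩

variable [SMulCommClass T S D]

variable (S T D X) in
/-- The evaluation map from a module to its bidual. -/
def evalMap : X →ₗ[S] ((X →ₗ[S] D) →ₗ[T] D) where
  toFun x :=
    { toFun := fun h => h x
      map_add' := fun _ _ => rfl
      map_smul' := fun _ _ => rfl }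
  map_add' x y := LinearMap.ext fun h => map_add h x y
  map_smul' s x := LinearMap.ext fun h => map_smul h s x

@[simp]
lemma evalMap_apply (x : X) (h : X →ₗ[S] D) : evalMap S T D X x h = h x :=
  rfl

variable (S T D) in
/-- Bimodules that are finitely generated projective on both sides, and over which each of the two
rings is the endomorphism ring of `D` over the other one. Since both rings act on the left, these
are the invertible `S`-`Tᵐᵒᵖ`-bimodules of Morita theory. -/
structure IsInvertibleBimodule : Prop where
  finite_left : Module.Finite S D
  projective_left : Module.Projective S D
  bijective_left : Function.Bijective (Module.toModuleEnd T (S := S) D)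
  finite_right : Module.Finite T D
  projective_right : Module.Projective T D
  bijective_right : Function.Bijective (Module.toModuleEnd S (S := T) D)

namespace IsInvertibleBimodule

lemma symm (hD : IsInvertibleBimodule S T D) : IsInvertibleBimodule T S D :=
  ⟨hD.finite_right, hD.projective_right, hD.bijective_right, hD.finite_left, hD.projective_left,
    hD.bijective_left⟩

/-- The isomorphism `S ≃ Hom_T(D, D)`. -/
noncomputable def endEquiv (hD : IsInvertibleBimodule S T D) : S ≃ₗ[S] (D →ₗ[T] D) :=
  .ofBijective (LinearMap.toSpanSingleton S (D →ₗ[T] D) .id) hD.bijective_left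

lemma endEquiv_apply (hD : IsInvertibleBimodule S T D) (s : S) (d : D) :
    hD.endEquiv s d = s • d :=
  rfl

lemma exists_retract (hD : IsInvertibleBimodule S T D) :
    ∃ (n : ℕ) (a : S →ₗ[S] (Fin n → D)) (b : (Fin n → D) →ₗ[S] S), b ∘ₗ a = .id := by
  have := hD.finite_right
  have := hD.projective_right
  -- Dualize a presentation of `D` as a retract of `T^n`.
  obtain ⟨n, f, g, -, -, hfg⟩ := Module.Finite.exists_comp_eq_id_of_projective T D
  refine ⟨n, (dualFreeEquiv T S D n).symm.toLinearMap ∘ₗ dualMap T S D f ∘ₗ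
    hD.endEquiv.toLinearMap, hD.endEquiv.symm.toLinearMap ∘ₗ dualMap T S D g ∘ₗ
    (dualFreeEquiv T S D n).toLinearMap, LinearMap.ext fun s => ?_⟩
  simp [LinearMap.comp_assoc, hfg]

lemma exists_extend (hD : IsInvertibleBimodule S T D) [Module.Finite S X] {f : X →ₗ[S] Y}
    (hf : ∀ k : X →ₗ[S] D, ∃ l : Y →ₗ[S] D, l ∘ₗ f = k) [Module.Projective S Z]
    (k : X →ₗ[S] Z) : ∃ l : Y →ₗ[S] Z, l ∘ₗ f = k := by
  have hfS (k : X →ₗ[S] S) : ∃ l : Y →ₗ[S] S, l ∘ₗ f = k := by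
    obtain ⟨n, a, b, hab⟩ := hD.exists_retract
    exact exists_extend_of_factor hf (a := a) (b := b)
      (by rw [← LinearMap.comp_assoc, hab, LinearMap.id_comp])
  obtain ⟨n, a, b, hab⟩ := exists_factor_finite_free k
  exact exists_extend_of_factor hfS hab

lemma projective_dual_free (hD : IsInvertibleBimodule S T D) (n : ℕ) :
    Module.Projective T ((Fin n → S) →ₗ[S] D) := by
  have := hD.projective_right
  exact .of_equiv ((DFinsupp.linearEquivFunOnFintype (R := T)).trans (dualFreeEquiv S T D n))

lemma finite_dual_free (hD : IsInvertibleBimodule S T D) (n : ℕ) :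
    Module.Finite T ((Fin n → S) →ₗ[S] D) := by
  have := hD.finite_right
  exact .equiv (dualFreeEquiv S T D n)

lemma finite_dual (hD : IsInvertibleBimodule S T D) [Module.Finite S X]
    (hX : IsGorensteinProjective S X) : Module.Finite T (X →ₗ[S] D) := by
  have := hD.projective_left
  obtain ⟨n, C, f, g, h, hC⟩ := hX.exists_finite_free_embedding
  have := hD.finite_dual_free n
  exact .of_surjective _ (h.dual (T := T) hC.isLeftOrthogonal).surjective

lemma bijective_evalMap_free (hD : IsInvertibleBimodule S T D) (n : ℕ) :
    Function.Bijective (evalMap S T D (Fin n → S)) := by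
  let e : (Fin n → S) ≃ₗ[S] (((Fin n → S) →ₗ[S] D) →ₗ[T] D) :=
    (LinearEquiv.piCongrRight fun _ => hD.endEquiv).trans
      ((LinearMap.lsum T (fun _ : Fin n => D) S).trans ((dualFreeEquiv S T D n).congrLeft D S))
  suffices h : evalMap S T D (Fin n → S) = e.toLinearMap from h ▸ e.bijective
  refine LinearMap.ext fun x => LinearMap.ext fun h => ?_
  obtain ⟨d, rfl⟩ := (dualFreeEquiv S T D n).surjective h
  simp [e, dualFreeEquiv_apply, endEquiv_apply]

lemma injective_evalMap (hD : IsInvertibleBimodule S T D) [Module.Finite S X]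
    (hX : IsGorensteinProjective S X) : Function.Injective (evalMap S T D X) := by
  obtain ⟨n, C, f, g, h, -⟩ := hX.exists_finite_free_embedding
  exact fun x y hxy => h.injective ((hD.bijective_evalMap_free n).1
    (LinearMap.ext fun k => LinearMap.congr_fun hxy (k ∘ₗ f)))

lemma bijective_evalMap (hD : IsInvertibleBimodule S T D) [Module.Finite S X]
    (hX : IsGorensteinProjective S X) : Function.Bijective (evalMap S T D X) := by
  have := hD.projective_left
  refine ⟨hD.injective_evalMap hX, fun φ => ?_⟩
  obtain ⟨n, C, f, g, h, hC⟩ := hX.exists_finite_free_embedding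
  have : Module.Finite S C := .of_surjective g h.surjective
  have hd := h.dual (T := T) (D := D) hC.isLeftOrthogonal
  obtain ⟨y, hy⟩ := (hD.bijective_evalMap_free n).2 (φ ∘ₗ dualMap S T D f)
  have hgy : g y = 0 := (injective_iff_map_eq_zero _).1 (hD.injective_evalMap hC) _ <|
    LinearMap.ext fun k => by
      have hk : φ (dualMap S T D f (dualMap S T D g k)) = 0 := by
        rw [hd.exact.apply_apply_eq_zero, map_zero]
      exact (LinearMap.congr_fun hy (k ∘ₗ g)).trans hk
  obtain ⟨x, rfl⟩ := (h.exact y).1 hgy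
  exact ⟨x, (LinearMap.cancel_right hd.surjective).1 hy⟩

lemma isLeftOrthogonal_dual (hD : IsInvertibleBimodule S T D) [Module.Finite S X]
    (hX : IsGorensteinProjective S X) : IsLeftOrthogonal T (X →ₗ[S] D) := by
  have := hD.projective_left
  refine .of_forall_syzygy (X := .of T (X →ₗ[S] D)) (W := fun Y => ∃ X : ModuleCat.{u} S,
    Module.Finite S X ∧ IsGorensteinProjective S X ∧ Y = .of T (X →ₗ[S] D)) ?_
    ⟨.of S X, ‹_›, hX, rfl⟩
  rintro _ ⟨X, hXf, hX, rfl⟩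
  obtain ⟨n, C, f, g, h, hC⟩ := hX.exists_finite_free_embedding
  have : Module.Finite S C := .of_surjective g h.surjective
  have := hD.finite_dual hC
  refine ⟨.of T (C →ₗ[S] D), .of T ((Fin n → S) →ₗ[S] D), _, _, hD.projective_dual_free n,
    h.dual hC.isLeftOrthogonal, ⟨C, ‹Module.Finite S C›, hC, rfl⟩, fun Q hQ k => ?_⟩
  -- By reflexivity, a map `C^* → D` is the evaluation at some `g x`, so it extends to `(S^n)^*`.
  refine hD.symm.exists_extend (fun k => ?_) k
  obtain ⟨c, rfl⟩ := (hD.bijective_evalMap hC).2 k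
  obtain ⟨x, rfl⟩ := h.surjective c
  exact ⟨evalMap S T D _ x, rfl⟩

lemma isGorensteinProjective_dual [IsCoherentRing S] (hD : IsInvertibleBimodule S T D)
    [Module.Finite S X] (hX : IsGorensteinProjective S X) :
    IsGorensteinProjective T (X →ₗ[S] D) := by
  have := hD.projective_left
  have hW : IsGorensteinClass fun Y => ∃ X : ModuleCat.{u} S,
      Module.Finite S X ∧ IsGorensteinProjective S X ∧ Y = .of T (X →ₗ[S] D) := by
    rintro _ ⟨X, hXf, hX, rfl⟩
    obtain ⟨n, g, hg⟩ := Module.Finite.exists_fin' S X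
    have h := IsShortExact.ker_subtype hg
    exact ⟨hD.isLeftOrthogonal_dual hX, .of T ((Fin n → S) →ₗ[S] D),
      .of T (LinearMap.ker g →ₗ[S] D), _, _, hD.projective_dual_free n, h.dual hX.isLeftOrthogonal,
      .of S (LinearMap.ker g), hX.finite_ker hg, .of_epi h .of_projective hX, rfl⟩
  exact InGorensteinClass.isGorensteinProjective (X := .of T (X →ₗ[S] D))
    ⟨_, hW, .of S X, ‹_›, hX, rfl⟩

end IsInvertibleBimodule

end Duality

section Comparison

variable {S T D : Type u} [Ring S] [Ring T] [AddCommGroup D] [Module S D] [Module T D]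
  [SMulCommClass S T D] {A B M N N' : Type u} [AddCommGroup A] [Module S A] [AddCommGroup B]
  [Module S B] [AddCommGroup M] [Module T M] [AddCommGroup N] [Module T N] [AddCommGroup N']
  [Module T N']

lemma GorensteinEmbeds.nonempty_extEquiv (hN : GorensteinEmbeds S A B) [Module.Projective S D]
    {i : ℕ} (hi : 1 ≤ i) : Nonempty (ExtD S D B i ≃ₗ[T] ExtD S D A i) := by
  obtain ⟨H, f, g, h, hH⟩ := hN
  exact hH.isLeftOrthogonal.nonempty_extEquiv T D h hi

lemma GorensteinEmbeds.congr (e : N ≃ₗ[T] N') (h : GorensteinEmbeds T N' M) :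
    GorensteinEmbeds T N M := by
  obtain ⟨H, f, g, h, hH⟩ := h
  exact ⟨H, _, g, h.precomp e, hH⟩

lemma IsTranspose.isGorensteinTranspose (h : IsTranspose S T D A M) :
    IsGorensteinTranspose S T D A M := by
  obtain ⟨P₁, P₀, f, p, hf₁, hf₀, hP₁, hP₀, h⟩ := h
  exact ⟨P₁, P₀, f, p, hf₁, hf₀, .of_projective, .of_projective, h⟩

variable (S T D A) in
lemma exists_isTranspose [Module.FinitePresentation S A] :
    ∃ M : ModuleCat.{u} T, IsTranspose S T D A M := by
  obtain ⟨n, m, p, f, hp, hfp⟩ := Module.FinitePresentation.exists_fin' S A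
  exact ⟨.of T (((Fin m → S) →ₗ[S] D) ⧸ LinearMap.range (dualMap S T D f)),
    .of S (Fin m → S), .of S (Fin n → S), f, p, inferInstanceAs (Module.Finite S (Fin m → S)),
    inferInstanceAs (Module.Finite S (Fin n → S)),
    inferInstanceAs (Module.Projective S (Fin m → S)),
    inferInstanceAs (Module.Projective S (Fin n → S)), hfp, hp, ⟨.refl _ _⟩⟩

lemma IsGorensteinTranspose.finitePresentation [IsCoherentRing S]
    (h : IsGorensteinTranspose S T D A M) : Module.FinitePresentation S A := by
  obtain ⟨X₁, X₀, g, p, hf₁, hf₀, -, h₀, hgp, hp, -⟩ := h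
  have := h₀.finitePresentation
  refine Module.finitePresentation_of_surjective p hp ?_
  rw [hgp.linearMap_ker_eq]
  exact Module.Finite.iff_fg.1 inferInstance

lemma exists_finite_free_square {S X Y B : Type*} [Ring S] [AddCommGroup X] [Module S X]
    [AddCommGroup Y] [Module S Y] [AddCommGroup B] [Module S B] [Module.Finite S X]
    [Module.Finite S Y] [Module.FinitePresentation S B] {a : X →ₗ[S] B} {c : Y →ₗ[S] B}
    (ha : Function.Surjective a) (hc : Function.Surjective c) :
    ∃ (n : ℕ) (u : (Fin n → S) →ₗ[S] X) (v : (Fin n → S) →ₗ[S] Y),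
      Function.Surjective u ∧ Function.Surjective v ∧ a ∘ₗ u = c ∘ₗ v := by
  let F := LinearMap.ker (a.coprod (-c))
  have hF (x : X) (y : Y) : (x, y) ∈ F ↔ a x = c y := by
    simp [F, ← sub_eq_add_neg, sub_eq_zero]
  have : Module.Finite S F := .of_fg <| Module.FinitePresentation.fg_ker _ fun b =>
    (ha b).imp' (fun x => (x, 0)) fun x hx => by simpa using hx
  obtain ⟨n, r, hr⟩ := Module.Finite.exists_fin' S F
  refine ⟨n, LinearMap.fst S X Y ∘ₗ F.subtype ∘ₗ r, LinearMap.snd S X Y ∘ₗ F.subtype ∘ₗ r,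
    fun x => ?_, fun y => ?_, LinearMap.ext fun z => (hF _ _).1 (r z).2⟩
  · obtain ⟨y, hy⟩ := hc (a x)
    obtain ⟨z, hz⟩ := hr ⟨(x, y), (hF x y).2 hy.symm⟩
    exact ⟨z, congrArg (fun w => w.1.1) hz⟩
  · obtain ⟨x, hx⟩ := ha (c y)
    obtain ⟨z, hz⟩ := hr ⟨(x, y), (hF x y).2 hx⟩
    exact ⟨z, congrArg (fun w => w.1.2) hz⟩

variable (S T D) in
/-- The cokernel of `g^* : Hom_S(X₀, D) → Hom_S(X₁, D)`. For a presentation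
`X₁ --g--> X₀ → A → 0` by finitely generated Gorenstein projective modules it is a Gorenstein
transpose of `A`. -/
abbrev DualCoker {X₁ X₀ : Type u} [AddCommGroup X₁] [Module S X₁] [AddCommGroup X₀] [Module S X₀]
    (g : X₁ →ₗ[S] X₀) : Type u :=
  (X₁ →ₗ[S] D) ⧸ LinearMap.range (dualMap S T D g)

section Presentation

variable {X₁ X₀ P Q Z : Type u} [AddCommGroup X₁] [Module S X₁] [AddCommGroup X₀] [Module S X₀]
  [AddCommGroup P] [Module S P] [AddCommGroup Q] [Module S Q] [AddCommGroup Z] [Module S Z]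

lemma exact_pullback_fst {g : X₁ →ₗ[S] X₀} {p : X₀ →ₗ[S] B} (h : Function.Exact g p)
    (u : P →ₗ[S] X₀) :
    Function.Exact (LinearMap.fst S P X₁ ∘ₗ (LinearMap.ker (u.coprod (-g))).subtype) (p ∘ₗ u) := by
  intro y
  rw [LinearMap.comp_apply, h (u y)]
  constructor
  · rintro ⟨x, hx⟩
    exact ⟨⟨(y, x), by simp [hx]⟩, rfl⟩
  · rintro ⟨⟨⟨y, x⟩, hz⟩, rfl⟩
    exact ⟨x, .symm (by simpa [← sub_eq_add_neg, sub_eq_zero] using hz)⟩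

lemma nonempty_dualCoker_pullback_equiv [Module.Projective S D] {g : X₁ →ₗ[S] X₀}
    (hX₀ : IsLeftOrthogonal S X₀) {u : P →ₗ[S] X₀} (hu : Function.Surjective u) :
    Nonempty (DualCoker S T D g ≃ₗ[T] DualCoker S T D
      (LinearMap.fst S P X₁ ∘ₗ (LinearMap.ker (u.coprod (-g))).subtype)) := by
  set Z := LinearMap.ker (u.coprod (-g))
  let π : Z →ₗ[S] P := LinearMap.fst S P X₁ ∘ₗ Z.subtype
  let ρ : Z →ₗ[S] X₁ := LinearMap.snd S P X₁ ∘ₗ Z.subtype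
  have h : IsShortExact Z.subtype (u.coprod (-g)) := .ker_subtype fun x =>
    (hu x).imp' (fun y => (y, 0)) fun y hy => by simpa using hy
  have hsq : u ∘ₗ π = g ∘ₗ ρ := LinearMap.ext fun ⟨z, hz⟩ => by
    simpa [← sub_eq_add_neg, sub_eq_zero, π, ρ, Z] using hz
  let c := (LinearMap.range (dualMap S T D π)).mkQ ∘ₗ dualMap S T D ρ
  have hc : Function.Surjective c := fun y => by
    obtain ⟨δ, rfl⟩ := Submodule.mkQ_surjective _ y
    obtain ⟨Δ, rfl⟩ := hX₀.exists_extend h δ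
    refine ⟨Δ ∘ₗ LinearMap.inr S P X₁, (Submodule.Quotient.eq _).2
      ⟨-(Δ ∘ₗ LinearMap.inl S P X₁), LinearMap.ext fun z => ?_⟩⟩
    have hz : Δ z.1 = Δ (z.1.1, 0) + Δ (0, z.1.2) := by rw [← map_add]; simp
    simp [π, ρ, hz]
  have hex : Function.Exact (dualMap S T D g) c := fun k => by
    refine (Submodule.Quotient.mk_eq_zero _).trans ⟨?_, ?_⟩
    · rintro ⟨l, hl⟩
      obtain ⟨m, hm⟩ := exists_comp_eq_of_exact h.exact h.surjective (k := l.coprod (-k))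
        (LinearMap.ext fun z => by
          simpa [← sub_eq_add_neg, sub_eq_zero, π, ρ] using LinearMap.congr_fun hl z)
      exact ⟨m, LinearMap.ext fun x => by simpa using LinearMap.congr_fun hm (0, x)⟩
    · rintro ⟨m, rfl⟩
      exact ⟨m ∘ₗ u, by rw [dualMap_apply, LinearMap.comp_assoc, hsq]; rfl⟩
  exact ⟨hex.linearEquivOfSurjective hc⟩

variable [IsCoherentRing S]

lemma exists_pullback_presentation [Module.Projective S D] [Module.Finite S X₁]
    [Module.Finite S X₀] [Module.Finite S P] [Module.Projective S P]
    (h₁ : IsGorensteinProjective S X₁) (h₀ : IsGorensteinProjective S X₀) {g : X₁ →ₗ[S] X₀}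
    {p : X₀ →ₗ[S] B} (h : Function.Exact g p) {u : P →ₗ[S] X₀} (hu : Function.Surjective u) :
    ∃ (Z : ModuleCat.{u} S) (π : Z →ₗ[S] P), Module.Finite S Z ∧ IsGorensteinProjective S Z ∧
      Function.Exact π (p ∘ₗ u) ∧ Nonempty (DualCoker S T D g ≃ₗ[T] DualCoker S T D π) := by
  have hv : Function.Surjective (u.coprod (-g)) := fun x =>
    (hu x).imp' (fun y => (y, 0)) fun y hy => by simpa using hy
  exact ⟨.of S (LinearMap.ker (u.coprod (-g))), _, h₀.finite_ker hv,
    .of_epi (.ker_subtype hv) (.prod .of_projective h₁) h₀, exact_pullback_fst h u,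
    nonempty_dualCoker_pullback_equiv h₀.isLeftOrthogonal hu⟩

variable [SMulCommClass T S D]

lemma IsInvertibleBimodule.gorensteinEmbeds_dualCoker_comp (hD : IsInvertibleBimodule S T D)
    [Module.Finite S Q] [Module.Projective S Q] [Module.Finite S Z]
    (hZ : IsGorensteinProjective S Z) (π : Z →ₗ[S] P) {w : Q →ₗ[S] Z}
    (hw : Function.Surjective w) :
    GorensteinEmbeds T (DualCoker S T D π) (DualCoker S T D (π ∘ₗ w)) := by
  have := hD.projective_left
  have h := IsShortExact.ker_subtype hw
  have := hZ.finite_ker hw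
  have hK : IsGorensteinProjective S (LinearMap.ker w) := .of_epi h .of_projective hZ
  obtain ⟨a, b, hab⟩ := IsShortExact.exists_coker_comp
    (LinearMap.exact_map_mkQ_range (dualMap S T D π)) (Submodule.mkQ_surjective _)
    (h.dual hZ.isLeftOrthogonal)
  exact ⟨.of T (LinearMap.ker w →ₗ[S] D), a, b, hab, hD.isGorensteinProjective_dual hK⟩

end Presentation

variable [SMulCommClass T S D] [IsCoherentRing S]

lemma exists_surjective_comp_eq {X Y : Type*} [AddCommGroup X] [Module S X] [AddCommGroup Y]
    [Module S Y] [Module.Finite S X] [Module.Finite S Y] {n : ℕ} {π : X →ₗ[S] (Fin n → S)}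
    {π' : Y →ₗ[S] (Fin n → S)} (h : LinearMap.range π = LinearMap.range π') :
    ∃ (m : ℕ) (w : (Fin m → S) →ₗ[S] X) (w' : (Fin m → S) →ₗ[S] Y),
      Function.Surjective w ∧ Function.Surjective w' ∧ π ∘ₗ w = π' ∘ₗ w' := by
  let c := π'.codRestrict (LinearMap.range π) fun y => h ▸ ⟨y, rfl⟩
  have hc : Function.Surjective c := fun ⟨z, hz⟩ => by
    obtain ⟨y, rfl⟩ := h ▸ hz
    exact ⟨y, rfl⟩
  have : Module.FinitePresentation S (LinearMap.range π) :=
    finitePresentation_of_injective (LinearMap.range π).injective_subtype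
  obtain ⟨m, w, w', hw, hw', hww'⟩ := exists_finite_free_square π.surjective_rangeRestrict hc
  exact ⟨m, w, w', hw, hw', LinearMap.ext fun z =>
    congrArg Subtype.val (LinearMap.congr_fun hww' z)⟩

namespace IsGorensteinTranspose

lemma exists_gorensteinEmbeds (hD : IsInvertibleBimodule S T D)
    (h : IsGorensteinTranspose S T D B N) (h' : IsGorensteinTranspose S T D B N') :
    ∃ E : ModuleCat.{u} T, GorensteinEmbeds T N E ∧ GorensteinEmbeds T N' E := by
  have := hD.projective_left
  have := h.finitePresentation
  obtain ⟨X₁, X₀, g, p, hXf₁, hXf₀, hX₁, hX₀, hgp, hp, ⟨e⟩⟩ := h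
  obtain ⟨Y₁, Y₀, g', p', hYf₁, hYf₀, hY₁, hY₀, hgp', hp', ⟨e'⟩⟩ := h'
  obtain ⟨n, u, u', hu, hu', huu'⟩ := exists_finite_free_square hp hp'
  obtain ⟨Z, π, _, hZ, hπ, ⟨i⟩⟩ :=
    exists_pullback_presentation (T := T) (D := D) hX₁ hX₀ hgp hu
  obtain ⟨Z', π', _, hZ', hπ', ⟨i'⟩⟩ :=
    exists_pullback_presentation (T := T) (D := D) hY₁ hY₀ hgp' hu'
  obtain ⟨m, w, w', hw, hw', hww'⟩ := exists_surjective_comp_eq (π := π) (π' := π')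
    (by rw [← hπ.linearMap_ker_eq, ← hπ'.linearMap_ker_eq, huu'])
  refine ⟨.of T (DualCoker S T D (π ∘ₗ w)),
    (hD.gorensteinEmbeds_dualCoker_comp hZ π hw).congr (e.trans i), ?_⟩
  rw [hww']
  exact (hD.gorensteinEmbeds_dualCoker_comp hZ' π' hw').congr (e'.trans i')

lemma nonempty_extEquiv (hD : IsInvertibleBimodule S T D)
    (h : IsGorensteinTranspose S T D B N) (h' : IsGorensteinTranspose S T D B N')
    {i : ℕ} (hi : 1 ≤ i) : Nonempty (ExtD T D N i ≃ₗ[S] ExtD T D N' i) := by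
  have := hD.projective_right
  obtain ⟨E, hE, hE'⟩ := h.exists_gorensteinEmbeds hD h'
  obtain ⟨e⟩ := hE.nonempty_extEquiv (T := S) (D := D) hi
  obtain ⟨e'⟩ := hE'.nonempty_extEquiv (T := S) (D := D) hi
  exact ⟨e.symm.trans e'⟩

lemma gpd_eq (hD : IsInvertibleBimodule S T D) (h : IsGorensteinTranspose S T D B N)
    (h' : IsGorensteinTranspose S T D B N') : Gpd T N = Gpd T N' := by
  obtain ⟨E, hE, hE'⟩ := h.exists_gorensteinEmbeds hD h'
  exact hE.gpd_eq.trans hE'.gpd_eq.symm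

lemma isTorsionfree_iff (hD : IsInvertibleBimodule S T D) (h : IsGorensteinTranspose S T D A M)
    (n : ℕ) : IsTorsionfree S T D n A ↔
      ∀ i : ℕ, 1 ≤ i → i ≤ n → Subsingleton (ExtD T D M i) := by
  constructor
  · rintro ⟨M', hM', hvan⟩ i hi hin
    obtain ⟨e⟩ := h.nonempty_extEquiv hD hM'.isGorensteinTranspose hi
    have := hvan i hi hin
    exact e.toEquiv.subsingleton
  · intro hvan
    have := h.finitePresentation
    obtain ⟨M', hM'⟩ := exists_isTranspose S T D A
    refine ⟨M', hM', fun i hi hin => ?_⟩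
    obtain ⟨e⟩ := h.nonempty_extEquiv hD hM'.isGorensteinTranspose hi
    have := hvan i hi hin
    exact e.symm.toEquiv.subsingleton

lemma symm (hD : IsInvertibleBimodule S T D) (h : IsGorensteinTranspose S T D A M) :
    IsGorensteinTranspose T S D M A := by
  obtain ⟨X₁, X₀, g, p, hf₁, hf₀, h₁, h₀, hgp, hp, ⟨e⟩⟩ := h
  let ev₁ := LinearEquiv.ofBijective _ (hD.bijective_evalMap h₁)
  let ev₀ := LinearEquiv.ofBijective _ (hD.bijective_evalMap h₀)
  have hev : ev₀.toLinearMap ∘ₗ g = dualMap T S D (dualMap S T D g) ∘ₗ ev₁.toLinearMap := rfl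
  have hrange : (LinearMap.range g).map ev₀.toLinearMap =
      LinearMap.range (dualMap T S D (dualMap S T D g)) := by
    rw [← LinearMap.range_comp, hev, LinearMap.range_comp_of_range_eq_top _ ev₁.range]
  refine ⟨.of T (X₀ →ₗ[S] D), .of T (X₁ →ₗ[S] D), dualMap S T D g,
    e.symm.toLinearMap ∘ₗ (LinearMap.range (dualMap S T D g)).mkQ, hD.finite_dual h₀,
    hD.finite_dual h₁, hD.isGorensteinProjective_dual h₀, hD.isGorensteinProjective_dual h₁,
    e.symm.injective.comp_exact_iff_exact.2 (LinearMap.exact_map_mkQ_range _),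
    e.symm.surjective.comp (Submodule.mkQ_surjective _), ⟨?_⟩⟩
  exact (hgp.linearEquivOfSurjective hp).symm.trans (Submodule.Quotient.equiv _ _ ev₀ hrange)

end IsGorensteinTranspose

lemma isInvertibleBimodule_self (R : Type u) [Ring R] : IsInvertibleBimodule R Rᵐᵒᵖ R := by
  let e : Rᵐᵒᵖ ≃ₗ[Rᵐᵒᵖ] R := { MulOpposite.opAddEquiv.symm with map_smul' := fun _ _ => rfl }
  refine ⟨inferInstance, inferInstance, ⟨fun r s h => ?_, fun φ => ⟨φ 1, ?_⟩⟩, .equiv e,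
    .of_equiv e, ⟨fun r s h => ?_, fun φ => ⟨.op (φ 1), ?_⟩⟩⟩
  · simpa using LinearMap.congr_fun h 1
  · ext
    simp
  · simpa using LinearMap.congr_fun h 1
  · ext
    simp

end Comparison

end GorensteinTranspose

open GorensteinTranspose in
theorem corollary3p5_general {S T D : Type u} [Ring S] [Ring T] [AddCommGroup D] [Module S D]
    [Module T D] [SMulCommClass S T D] [SMulCommClass T S D] [IsCoherentRing S] [IsCoherentRing T]
    (hD : IsInvertibleBimodule S T D) {A M N : Type u} [AddCommGroup A] [Module S A]
    [AddCommGroup M] [Module T M] [AddCommGroup N] [Module S N]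
    (hM : IsGorensteinTranspose S T D A M) (hN : IsGorensteinTranspose T S D M N) :
    (∀ i, 1 ≤ i → Nonempty (ExtD S D N i ≃ₗ[T] ExtD S D A i)) ∧
    (∀ n, IsTorsionfree S T D n N ↔ IsTorsionfree S T D n A) ∧
    Gpd S N = Gpd S A := by
  have hA : IsGorensteinTranspose T S D M A := hM.symm hD
  have hM' : IsGorensteinTranspose S T D N M := hN.symm hD.symm
  exact ⟨fun i hi => hN.nonempty_extEquiv hD.symm hA hi,
    fun n => (hM'.isTorsionfree_iff hD n).trans (hM.isTorsionfree_iff hD n).symm,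
    hN.gpd_eq hD.symm hA⟩

open GorensteinTranspose in
theorem corollary3p5 (R : Type u) [Ring R] [IsNoetherianRing R] [IsNoetherianRing Rᵐᵒᵖ]
    (A : Type u) [AddCommGroup A] [Module R A] [Module.Finite R A]
    (M : Type u) [AddCommGroup M] [Module Rᵐᵒᵖ M]
    (hM : IsGorensteinTranspose R Rᵐᵒᵖ R A M)
    (N : Type u) [AddCommGroup N] [Module R N]
    (hN : IsGorensteinTranspose Rᵐᵒᵖ R R M N) :
    (∀ i : ℕ, 1 ≤ i → Nonempty (ExtD R R N i ≃ₗ[Rᵐᵒᵖ] ExtD R R A i)) ∧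
    (∀ n : ℕ, 1 ≤ n → (IsTorsionfree R Rᵐᵒᵖ R n N ↔ IsTorsionfree R Rᵐᵒᵖ R n A)) ∧
    Gpd R N = Gpd R A := by
  have ⟨hExt, hTorsionfree, hGpd⟩ := corollary3p5_general (isInvertibleBimodule_self R) hM hN
  exact ⟨hExt, fun n _ => hTorsionfree n, hGpd⟩
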